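/- Let $n\ge 2$ and let $[n]=\{1,\dots,n\}$ be the vertex set of the cycle graph $C_n$, with its cyclic order (for $n=2$, $C_2$ is a single edge). For $i,j\in[n]$ let $[i,j)^0\subseteq[n]$ be the half-open circular interval of vertices met when going around the cycle in the positive direction from $i$ (included) to $j$ (excluded), with $[i,i)^0=\emptyset$, and put $d(i,j)=|[i,j)^0|$ and $$\rho(i,j)=d(i,j)\,\frac{n^2-n+1}{n}-\frac{d(i,j)\,(d(i,j)+1)}{2}.$$ Then $d$ (the clock quasi-metric) and $\rho$ are quasi-metrics on $[n]$, that is, they are nonnegative, vanish exactly when $i=j$, and satisfy the triangle inequality (symmetry is not required). Moreover, the Kantorovich–Rubinstein polytope $$KR(\rho)=\mathrm{Conv}\Big\{\frac{e_i-e_j}{\rho(i,j)} \;\Big|\; 1\le i\ne j\le n\Big\}\subset\mathbb{R}^n$$ is affinely isomorphic to the dual $W_n^\circ$ of the standard cyclohedron $W_n$: there is an affine map $\mathbb{R}^n\to\mathbb{R}^n$ that restricts to a bijection from $KR(\rho)$ onto $W_n^\circ$. Here $W_n=\sum_{F}\mathrm{Conv}\{e_i\mid i\in F\}$ is the Minkowski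 sum over all nonempty $F\subseteq[n]$ that induce a connected subgraph of $C_n$; it lies in the hyperplane $x_1+\dots+x_n=n^2-n+1$. Its dual $W_n^\circ$ is the polar, inside $H_0=\{y\in\mathbb{R}^n\mid y_1+\dots+y_n=0\}$, of the translate $W_n^0=W_n-\frac{n^2-n+1}{n}(e_1+\dots+e_n)\subset H_0$, i.e. $W_n^\circ=\{y\in H_0\mid \langle x,y\rangle\le 1\text{ for all }x\in W_n^0\}$. -/

import Mathlib

noncomputable section

namespace CycloKR

/-- A quasi-metric (asymmetric distance function) on `X`. -/
structure IsQuasiMetric {X : Type*} (ρ : X → X → ℝ) : Prop where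
  nonneg : ∀ x y, 0 ≤ ρ x y
  eq_zero_iff : ∀ x y, ρ x y = 0 ↔ x = y
  triangle : ∀ x y z, ρ x z ≤ ρ x y + ρ y z

/-- The Kantorovich-Rubinstein polytope of `ρ`: the convex hull of the points
`(e_x - e_y) / ρ(x, y)` with `x ≠ y` in `ℝ^X`. -/
def KR {X : Type*} [Fintype X] [DecidableEq X] (ρ : X → X → ℝ) : Set (EuclideanSpace ℝ X) :=
  convexHull ℝ {v | ∃ x y : X, x ≠ y ∧
    v = (ρ x y)⁻¹ • (EuclideanSpace.single x (1 : ℝ) - EuclideanSpace.single y (1 : ℝ))}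

/-- The discrete half-open circular interval `[i, j)⁰`. Subtraction in `Fin n` is modulo `n`, so
`k` belongs to it when, walking around the cycle in the positive direction from `i`, one reaches
`k` strictly before `j`; in particular `[i, i)⁰ = ∅`. -/
def arc {n : ℕ} (i j : Fin n) : Finset (Fin n) :=
  Finset.univ.filter fun k => k - i < j - i

/-- The clock quasi-metric `d(i, j) = |[i, j)⁰|`. -/
def clockDist {n : ℕ} (i j : Fin n) : ℝ := ((arc i j).card : ℝ)

/-- `ρ(i, j) = d(i, j) (n² - n + 1) / n - d(i, j) (d(i, j) + 1) / 2`. -/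
def cycloDist {n : ℕ} (i j : Fin n) : ℝ :=
  clockDist i j * (((n : ℝ) ^ 2 - (n : ℝ) + 1) / (n : ℝ)) -
    clockDist i j * (clockDist i j + 1) / 2

open Classical in
/-- The graphical building set `Con(G)`: all nonempty sets of vertices that induce a connected
subgraph of `G` (`SimpleGraph.Connected` includes non-emptiness). -/
def connectedSets {V : Type*} [Fintype V] (G : SimpleGraph V) : Finset (Finset V) :=
  Finset.univ.filter fun S => (G.induce (S : Set V)).Connected

/-- The simplex `Δ_S = Conv {e_i | i ∈ S}`. -/
def simplex {V : Type*} [Fintype V] [DecidableEq V] (S : Finset V) :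
    Set (EuclideanSpace ℝ V) :=
  convexHull ℝ {v | ∃ i ∈ S, v = EuclideanSpace.single i (1 : ℝ)}

section
open scoped Pointwise

/-- The Minkowski sum `Δ_𝓕 = ∑_{F ∈ 𝓕} Δ_F` of the simplices of a hypergraph `𝓕`. -/
def hypergraphPolytope {V : Type*} [Fintype V] [DecidableEq V] (F : Finset (Finset V)) :
    Set (EuclideanSpace ℝ V) :=
  ∑ S ∈ F, simplex S

end

/-- The standard cyclohedron `W_n ⊆ ℝⁿ`, the nestohedron `Δ_𝓕` of the building set
`𝓕 = Con(C_n)` of the cycle graph on `n` vertices. -/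
def cyclohedron (n : ℕ) : Set (EuclideanSpace ℝ (Fin n)) :=
  hypergraphPolytope (connectedSets (SimpleGraph.cycleGraph n))

/-- The canonical map `x ↦ x - ((x_1 + ⋯ + x_n) / n) (e_1 + ⋯ + e_n)`; on each hyperplane
`x_1 + ⋯ + x_n = ν` it is the translation onto `H_0`. -/
def toH0 {V : Type*} [Fintype V] (x : EuclideanSpace ℝ V) : EuclideanSpace ℝ V :=
  WithLp.toLp 2 fun i => x i - (∑ j, x j) / (Fintype.card V : ℝ)

/-- The polar dual of `K` inside the hyperplane `H_0 = {y | y_1 + ⋯ + y_n = 0}`. -/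
def polarH0 {V : Type*} [Fintype V] (K : Set (EuclideanSpace ℝ V)) : Set (EuclideanSpace ℝ V) :=
  {y | ∑ i, y i = 0 ∧ ∀ x ∈ K, inner ℝ x y ≤ 1}

/-- The dual `W_n°` of the standard cyclohedron, polarity being taken in `H_0` after the canonical
translation of `W_n` to `H_0`. -/
def dualCyclohedron (n : ℕ) : Set (EuclideanSpace ℝ (Fin n)) :=
  polarH0 (toH0 '' cyclohedron n)

/-- Two polytopes are affinely isomorphic if some affine map between the ambient spaces restricts
to a bijection between them. -/
def AffinelyIsomorphic {E F : Type*} [AddCommGroup E] [Module ℝ E] [AddCommGroup F] [Module ℝ F]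
    (P : Set E) (Q : Set F) : Prop :=
  ∃ φ : E →ᵃ[ℝ] F, Set.BijOn φ P Q

end CycloKR

end

namespace CycloKR

open scoped Pointwise

/-! Up to constants, the outer normals of the facets of $W_n$ are minus the indicators of proper
arcs, the connected sets other than $[n]$. The linear map `arcMap` sends $e_i-e_j$ to the centred
$-1_{[i,j)^0}$, and `cycloDist_eq` identifies $\rho(i,j)$ with the value of the support function of
$W_n^0$ there: each simplex $\Delta_S$ with $S\subseteq[i,j)^0$ puts mass exactly 1 on the arc, and
the others put at least 0. Hence generators of $KR(\rho)$ land in the polar. Conversely, for $y\in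
W_n^\circ$, `exists_nested_decomposition` writes $\max y-y=\sum_F a_F1_F$ so that the maximum of $y$
on each connected $S$ is $\max y-\sum_{F\supseteq S}a_F$. Choosing a maximiser in every $S$ gives a
point of $W_n$ whose pairing with $y$ is $\sum_F a_F\rho(F)\le 1$. These are the weights of $y$ on
the normalised images of the generators, and $0\in KR(\rho)$ takes the missing mass. -/

/-! ### Nested decompositions over a building set -/

/-- Every nonnegative function is a nonnegative combination of indicators of members of a building
set `B`, in such a way that its minimum over any member of `B` is read off from the coefficients. -/
lemma exists_nested_decomposition {V : Type*} [Fintype V] [DecidableEq V] (B : Finset (Finset V))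
    (hsing : ∀ v, {v} ∈ B)
    (hunion : ∀ S ∈ B, ∀ T ∈ B, (S ∩ T).Nonempty → S ∪ T ∈ B)
    (hne : ∀ S ∈ B, S.Nonempty) (z : V → ℝ) (hz : ∀ v, 0 ≤ z v) :
    ∃ a : Finset V → ℝ, (∀ F, 0 ≤ a F) ∧ (∀ v, z v = ∑ F ∈ B, if v ∈ F then a F else 0) ∧
      ∀ S ∈ B, ∃ v ∈ S, z v = ∑ F ∈ B, if S ⊆ F then a F else 0 := by
  induction hk : (Finset.univ.filter fun v => z v ≠ 0).card using Nat.strong_induction_on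
    generalizing z with
  | _ k ih =>
  by_cases hsupp : ∀ v, z v = 0
  · refine ⟨fun _ => 0, fun _ => le_rfl, fun v => by simp [hsupp], fun S hS => ?_⟩
    obtain ⟨v, hv⟩ := hne S hS
    exact ⟨v, hv, by simp [hsupp]⟩
  push Not at hsupp
  obtain ⟨v₀, hv₀⟩ := hsupp
  -- Peel off a maximal member of `B` inside the support of `z`, with coefficient the minimum of `z`
  -- on it; the support shrinks.
  obtain ⟨C, hC⟩ := Finset.exists_maximal (s := B.filter fun S => ∀ v ∈ S, z v ≠ 0)
    ⟨{v₀}, by simp [hsing, hv₀]⟩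
  have hCB : C ∈ B := (Finset.mem_filter.1 hC.1).1
  have hCz : ∀ v ∈ C, z v ≠ 0 := (Finset.mem_filter.1 hC.1).2
  have habsorb : ∀ S ∈ B, (∀ v ∈ S, z v ≠ 0) → (S ∩ C).Nonempty → S ⊆ C := by
    intro S hS hSz hSC
    have hmem : S ∪ C ∈ B.filter fun S => ∀ v ∈ S, z v ≠ 0 := by
      refine Finset.mem_filter.2 ⟨hunion S hS C hCB hSC, fun v hv => ?_⟩
      exact (Finset.mem_union.1 hv).elim (hSz v) (hCz v)
    exact Finset.subset_union_left.trans (hC.2 hmem Finset.subset_union_right)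
  obtain ⟨c, hcC, hcmin⟩ := C.exists_min_image z (hne C hCB)
  have hcpos : 0 < z c := lt_of_le_of_ne (hz c) (hCz c hcC).symm
  obtain ⟨a, ha0, haz, haS⟩ := ih _ (by
      rw [← hk]
      refine Finset.card_lt_card (Finset.ssubset_iff_of_subset ?_ |>.2 ⟨c, ?_, ?_⟩)
      · intro v
        by_cases hv : v ∈ C
        · simp [hCz v hv]
        · simp [hv]
      · simp [hcpos.ne']
      · simp [hcC]) (fun v => z v - if v ∈ C then z c else 0) (fun v => by
      by_cases hv : v ∈ C
      · simpa [hv] using hcmin v hv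
      · simpa [hv] using hz v) rfl
  have hsum : ∀ p : Finset V → Prop, [DecidablePred p] →
      (∑ F ∈ B, if p F then a F + (if F = C then z c else 0) else 0) =
        (∑ F ∈ B, if p F then a F else 0) + if p C then z c else 0 := by
    intro p _
    have h : ∀ F ∈ B, (if p F then a F + (if F = C then z c else 0) else 0) =
        (if p F then a F else 0) + if F = C then (if p C then z c else 0) else 0 := by
      intro F _
      by_cases hF : F = C
      · subst hF; by_cases hp : p F <;> simp [hp]
      · by_cases hp : p F <;> simp [hp, hF]
    rw [Finset.sum_congr rfl h, Finset.sum_add_distrib]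
    simp [hCB]
  refine ⟨fun F => a F + if F = C then z c else 0, fun F => ?_, fun v => ?_, fun S hS => ?_⟩
  · exact add_nonneg (ha0 F) (by split_ifs <;> simp [hcpos.le])
  · rw [hsum fun F => v ∈ F, ← haz v]; ring
  · obtain ⟨v, hvS, hv⟩ := haS S hS
    simp_rw [hsum fun F => S ⊆ F]
    by_cases hSC : S ⊆ C
    · exact ⟨v, hvS, by rw [← hv]; simp [hSC, hSC hvS]⟩
    by_cases hvC : v ∈ C
    -- Here `S` meets `C` without lying in it, so by maximality of `C` it leaves the support; a zero
    -- of `z` in `S` replaces `v`.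
    · have : ∃ w ∈ S, z w = 0 := by
        by_contra! h
        exact hSC (habsorb S hS h ⟨v, Finset.mem_inter.2 ⟨hvS, hvC⟩⟩)
      obtain ⟨w, hwS, hw⟩ := this
      have hwC : w ∉ C := fun h => hCz w h hw
      refine ⟨w, hwS, ?_⟩
      have h1 : (∑ F ∈ B, if S ⊆ F then a F else 0) ≤ ∑ F ∈ B, if w ∈ F then a F else 0 := by
        refine Finset.sum_le_sum fun F _ => ?_
        by_cases hF : S ⊆ F
        · simp [hF, hF hwS]
        · by_cases hwF : w ∈ F <;> simp [hF, hwF, ha0]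
      have h2 : 0 ≤ ∑ F ∈ B, if S ⊆ F then a F else 0 :=
        Finset.sum_nonneg fun F _ => by split_ifs <;> simp [ha0]
      rw [← haz w] at h1
      simp only [hwC, if_false, hw] at h1
      simp only [hSC, if_false, hw]
      linarith
    · exact ⟨v, hvS, by rw [← hv]; simp [hSC, hvC]⟩

/-- A nonempty set that is closed under adjacency inside a connected set is all of it. -/
lemma subset_of_induce_connected {V : Type*} {G : SimpleGraph V} {S T : Set V}
    (hS : (G.induce S).Connected) {a : V} (haS : a ∈ S) (haT : a ∈ T)
    (hT : ∀ u ∈ T, ∀ v ∈ S, G.Adj u v → v ∈ T) : S ⊆ T := by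
  intro b hb
  obtain ⟨p⟩ := hS.preconnected ⟨a, haS⟩ ⟨b, hb⟩
  suffices ∀ (u v : S), (G.induce S).Walk u v → u.1 ∈ T → v.1 ∈ T from this _ _ p haT
  intro u v p
  induction p with
  | nil => exact id
  | @cons u w v h _ ih => exact fun hu => ih (hT _ hu _ w.2 h)

/-! ### Arithmetic of circular arcs -/

lemma val_sub_eq_ite {n : ℕ} (a b : Fin n) :
    (a - b).val = if b.val ≤ a.val then a.val - b.val else n + a.val - b.val := by
  have ha := a.2
  have hb := b.2
  rw [Fin.val_sub]
  split_ifs with h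
  · rw [show n - b.val + a.val = a.val - b.val + n by omega, Nat.add_mod_right,
      Nat.mod_eq_of_lt (by omega)]
  · rw [Nat.mod_eq_of_lt (by omega)]; omega

lemma mem_arc {n : ℕ} {i j k : Fin n} : k ∈ arc i j ↔ k - i < j - i := by
  simp [arc]

lemma left_mem_arc {n : ℕ} {i j : Fin n} (h : i ≠ j) : i ∈ arc i j := by
  rw [mem_arc, Fin.lt_def, val_sub_eq_ite, val_sub_eq_ite]
  have := i.2
  have := j.2
  have := Fin.val_ne_of_ne h
  split_ifs <;> omega

lemma right_notMem_arc {n : ℕ} (i j : Fin n) : j ∉ arc i j := by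
  simp [mem_arc]

lemma card_arc {n : ℕ} (i j : Fin n) : (arc i j).card = (j - i).val := by
  have : NeZero n := ⟨fun h => (h ▸ i).elim0⟩
  have h : arc i j = (Finset.Iio (j - i)).map (Equiv.addRight i).toEmbedding := by
    ext k
    simp [mem_arc, sub_eq_add_neg]
  rw [h, Finset.card_map, Fin.card_Iio]

/-- If `p < q` then `[i + p, i + q)⁰` consists of the points at distance in `[p, q)` from `i`. -/
lemma mem_arc_add {n : ℕ} [NeZero n] {i p q k : Fin n} (h : p < q) :
    k ∈ arc (i + p) (i + q) ↔ p ≤ k - i ∧ k - i < q := by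
  rw [mem_arc, ← sub_sub, add_sub_add_left_eq_sub]
  generalize k - i = x
  rw [Fin.lt_def, Fin.lt_def, Fin.le_def, val_sub_eq_ite, val_sub_eq_ite]
  rw [Fin.lt_def] at h
  have := x.2
  have := p.2
  have := q.2
  split_ifs <;> omega

lemma val_sub_one {n : ℕ} [NeZero n] (x : Fin n) (hn : 2 ≤ n) :
    (x - 1).val = if x.val = 0 then n - 1 else x.val - 1 := by
  have h1 : (1 : Fin n).val = 1 := by rw [Fin.val_one', Nat.mod_eq_of_lt (by omega)]
  rw [val_sub_eq_ite, h1]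
  split_ifs <;> omega

/-- The first vertex of a proper arc is characterised among its vertices. -/
lemma sub_one_mem_arc {n : ℕ} [NeZero n] (hn : 2 ≤ n) {i j k : Fin n} (hk : k ∈ arc i j) :
    k - 1 ∈ arc i j ↔ k ≠ i := by
  rw [mem_arc, Fin.lt_def] at *
  have h0 : k ≠ i ↔ (k - i).val ≠ 0 := by
    rw [Ne, ← sub_eq_zero, Fin.ext_iff, Fin.val_zero]
  rw [h0, sub_right_comm, val_sub_one _ hn]
  have := (k - i).2
  have := (j - i).2
  split_ifs <;> omega

/-- The start is the only vertex of the arc whose predecessor lies outside; the cardinality then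
fixes the end. -/
lemma arc_injective {n : ℕ} (hn : 2 ≤ n) {i j i' j' : Fin n} (h : i ≠ j)
    (heq : arc i j = arc i' j') : i = i' ∧ j = j' := by
  have : NeZero n := ⟨by omega⟩
  have hi := left_mem_arc h
  have h1 := (sub_one_mem_arc hn hi).not.2 (by simp)
  have hii : i = i' := by
    by_contra hne
    rw [heq] at hi h1
    exact h1 ((sub_one_mem_arc hn hi).2 hne)
  subst hii
  have hc := congrArg Finset.card heq
  rw [card_arc, card_arc] at hc
  exact ⟨rfl, by simpa using Fin.ext hc⟩

/-! ### Connected sets of the cycle -/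

lemma mem_connectedSets {V : Type*} [Fintype V] {G : SimpleGraph V} {S : Finset V} :
    S ∈ connectedSets G ↔ (G.induce (S : Set V)).Connected := by
  simp [connectedSets]

lemma cycleGraph_adj_iff {n : ℕ} [NeZero n] (hn : 2 ≤ n) {u v : Fin n} :
    (SimpleGraph.cycleGraph n).Adj u v ↔ v = u + 1 ∨ v = u - 1 := by
  obtain ⟨m, rfl⟩ : ∃ m, n = m + 2 := ⟨n - 2, by omega⟩
  rw [SimpleGraph.cycleGraph_adj, or_comm]
  refine or_congr ⟨fun h => ?_, fun h => ?_⟩ ⟨fun h => ?_, fun h => ?_⟩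
  · rw [← h]; simp
  · rw [h]; simp
  · rw [← h]; simp
  · rw [h]; simp

lemma arc_mem_connectedSets {n : ℕ} (hn : 2 ≤ n) {i j : Fin n} (h : i ≠ j) :
    arc i j ∈ connectedSets (SimpleGraph.cycleGraph n) := by
  have : NeZero n := ⟨by omega⟩
  rw [mem_connectedSets]
  -- Grow the arc one vertex at a time, from length 1 because the empty set is not connected.
  suffices ∀ d : ℕ, d + 1 ≤ n → ((SimpleGraph.cycleGraph n).induce
      {k : Fin n | (k - i).val < d + 1}).Connected by
    have hpos : 0 < (j - i).val := by
      rw [← card_arc]; exact Finset.card_pos.2 ⟨i, left_mem_arc h⟩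
    have hset : (arc i j : Set (Fin n)) = {k : Fin n | (k - i).val < (j - i).val - 1 + 1} := by
      ext k
      simp only [Finset.mem_coe, mem_arc, Fin.lt_def, Set.mem_ofPred_eq]
      omega
    rw [hset]
    exact this _ (by omega)
  intro d
  induction d with
  | zero =>
    intro _
    have : {k : Fin n | (k - i).val < 0 + 1} = {i} := by
      ext k
      have : k = i ↔ (k - i).val = 0 := by rw [← sub_eq_zero, Fin.ext_iff, Fin.val_zero]
      simp only [Set.mem_ofPred_eq, Set.mem_singleton_iff, this]
      omega
    rw [this]
    exact SimpleGraph.Connected.of_subsingleton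
  | succ d ih =>
    intro hd
    have hval : ∀ (e : ℕ) (he : e < n) (k : Fin n), k = i + ⟨e, he⟩ ↔ (k - i).val = e := by
      intro e he k
      rw [← sub_eq_iff_eq_add', Fin.ext_iff]
    have hset : {k : Fin n | (k - i).val < d + 1 + 1} =
        {k : Fin n | (k - i).val < d + 1} ∪ {i + ⟨d + 1, by omega⟩} := by
      ext k
      simp only [Set.mem_union, Set.mem_ofPred_eq, Set.mem_singleton_iff, hval]
      omega
    rw [hset]
    refine SimpleGraph.connected_induce_union (ih (by omega)).preconnected
      SimpleGraph.Preconnected.of_subsingleton (v := i + ⟨d, by omega⟩) (w := i + ⟨d + 1, by omega⟩)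
      (by simp) rfl ?_
    refine SimpleGraph.Adj.symm ((cycleGraph_adj_iff hn).2 (Or.inr ?_))
    rw [add_sub_assoc, add_right_inj, Fin.ext_iff, val_sub_one _ hn]
    simp

lemma mem_connectedSets_cycleGraph {n : ℕ} (hn : 2 ≤ n) {S : Finset (Fin n)} :
    S ∈ connectedSets (SimpleGraph.cycleGraph n) ↔
      S = Finset.univ ∨ ∃ i j, i ≠ j ∧ S = arc i j := by
  have : NeZero n := ⟨by omega⟩
  constructor
  · intro hS
    rw [mem_connectedSets] at hS
    refine or_iff_not_imp_left.2 fun hU => ?_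
    obtain ⟨⟨s, hs⟩⟩ := hS.nonempty
    -- A nonempty set closed under predecessors is the whole cycle, so a proper one has a first
    -- vertex `a`; `t` below is the first exit from `S` after `a`.
    obtain ⟨a, haS, ha⟩ : ∃ a ∈ S, a - 1 ∉ S := by
      by_contra! h
      refine hU (Finset.eq_univ_iff_forall.2 fun k => ?_)
      induction hm : (s - k).val generalizing k with
      | zero => rwa [← sub_eq_zero.1 (Fin.ext (by simpa using hm) : s - k = 0)]
      | succ m ih =>
        have := h _ (ih (k + 1) (by rw [← sub_sub, val_sub_one _ hn, if_neg (by omega)]; omega))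
        simpa using this
    obtain ⟨t, ht⟩ := Finset.exists_minimal (s := Finset.univ.filter fun x => a + x ∉ S)
      ⟨-1, by simpa [sub_eq_add_neg] using ha⟩
    have htS : a + t ∉ S := (Finset.mem_filter.1 ht.1).2
    have hmin : ∀ x, x < t → a + x ∈ S := by
      intro x hx
      by_contra h
      exact absurd (ht.2 (Finset.mem_filter.2 ⟨Finset.mem_univ _, h⟩) hx.le) (not_le.2 hx)
    have hat : a ≠ a + t := fun h => htS (h ▸ haS)
    refine ⟨a, a + t, hat, Finset.Subset.antisymm ?_ ?_⟩
    · refine Finset.coe_subset.1 (subset_of_induce_connected hS haS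
        (Finset.mem_coe.2 (left_mem_arc hat)) ?_)
      intro u hu v hv huv
      rw [Finset.mem_coe] at *
      rcases (cycleGraph_adj_iff hn).1 huv with rfl | rfl
      · by_contra hnot
        have hvt : u + 1 ≠ a + t := fun h => htS (h ▸ hv)
        have hva : u + 1 ≠ a := by
          rintro rfl
          exact hnot (left_mem_arc hat)
        have h1 : (u - a).val < t.val := by simpa [mem_arc] using hu
        have h2 : t.val ≤ (u + 1 - a).val := by simpa [mem_arc] using hnot
        have h3 : (u + 1 - a).val ≠ t.val := fun h => hvt (by rw [← Fin.ext h]; simp)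
        have h4 := val_sub_one (u + 1 - a) hn
        rw [show u + 1 - a - 1 = u - a by abel] at h4
        have := (u + 1 - a).2
        split_ifs at h4 <;> omega
      · refine (sub_one_mem_arc hn hu).2 ?_
        rintro rfl
        exact ha hv
    · intro k hk
      have := hmin (k - a) (by simpa [mem_arc] using hk)
      simpa using this
  · rintro (rfl | ⟨i, j, hij, rfl⟩)
    · obtain ⟨m, rfl⟩ : ∃ m, n = m + 1 := ⟨n - 1, by omega⟩
      rw [mem_connectedSets, Finset.coe_univ]
      exact (SimpleGraph.induceUnivIso _).connected_iff.2 SimpleGraph.cycleGraph_connected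
    · exact arc_mem_connectedSets hn hij

/-! ### The two quasi-metrics -/

lemma clockDist_eq {n : ℕ} (i j : Fin n) : clockDist i j = ((j - i).val : ℝ) := by
  rw [clockDist, card_arc]

lemma val_sub_triangle {n : ℕ} (x y z : Fin n) :
    (z - x).val = (y - x).val + (z - y).val ∨ (z - x).val + n = (y - x).val + (z - y).val := by
  rw [val_sub_eq_ite, val_sub_eq_ite, val_sub_eq_ite]
  have := x.2
  have := y.2
  have := z.2
  split_ifs <;> omega

lemma val_sub_eq_zero_iff {n : ℕ} (x y : Fin n) : (y - x).val = 0 ↔ x = y := by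
  rw [val_sub_eq_ite, Fin.ext_iff]
  have := x.2
  have := y.2
  split_ifs <;> omega

lemma isQuasiMetric_clockDist (n : ℕ) : IsQuasiMetric (clockDist : Fin n → Fin n → ℝ) where
  nonneg x y := by rw [clockDist_eq]; positivity
  eq_zero_iff x y := by rw [clockDist_eq, Nat.cast_eq_zero, val_sub_eq_zero_iff]
  triangle x y z := by
    simp_rw [clockDist_eq]
    have := val_sub_triangle x y z
    exact_mod_cast (by omega : (z - x).val ≤ (y - x).val + (z - y).val)

/-- Factor out $d$: since $d\le n-1$, one has $(d+1)/2\le n/2\le n-1<n-1+1/n$. -/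
lemma cycloDist_pos {n : ℕ} (hn : 2 ≤ n) {x y : Fin n} (h : x ≠ y) : 0 < cycloDist x y := by
  rw [cycloDist, clockDist_eq]
  have h0 : (y - x).val ≠ 0 := (val_sub_eq_zero_iff x y).not.2 h
  have h1 : (1 : ℝ) ≤ (y - x).val := by exact_mod_cast Nat.one_le_iff_ne_zero.2 h0
  have h2 : ((y - x).val : ℝ) + 1 ≤ n := by exact_mod_cast (y - x).2
  have hn' : (2 : ℝ) ≤ n := by exact_mod_cast hn
  have h3 : ((n : ℝ) ^ 2 - n + 1) / n = n - 1 + 1 / n := by field_simp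
  have h4 : (0 : ℝ) < 1 / n := by positivity
  rw [h3]
  generalize ((y - x).val : ℝ) = d at *
  nlinarith

lemma isQuasiMetric_cycloDist {n : ℕ} (hn : 2 ≤ n) :
    IsQuasiMetric (cycloDist : Fin n → Fin n → ℝ) where
  nonneg x y := by
    by_cases h : x = y
    · subst h
      simp [cycloDist, ((isQuasiMetric_clockDist n).eq_zero_iff x x).2 rfl]
    · exact (cycloDist_pos hn h).le
  eq_zero_iff x y := by
    constructor
    · contrapose!
      exact fun h => (cycloDist_pos hn h).ne'
    · rintro rfl
      simp [cycloDist, ((isQuasiMetric_clockDist n).eq_zero_iff x x).2 rfl]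
  triangle x y z := by
    simp only [cycloDist, clockDist_eq]
    have ha : ((y - x).val : ℝ) ≤ n := by exact_mod_cast (y - x).2.le
    have hb : ((z - y).val : ℝ) ≤ n := by exact_mod_cast (z - y).2.le
    have hn' : (2 : ℝ) ≤ n := by exact_mod_cast hn
    set c : ℝ := ((n : ℝ) ^ 2 - n + 1) / n with hc
    have hcn : c * n = (n : ℝ) ^ 2 - n + 1 := by rw [hc]; field_simp
    have ha0 : (0 : ℝ) ≤ (y - x).val := by positivity
    have hb0 : (0 : ℝ) ≤ (z - y).val := by positivity
    -- With $a=d(x,y)$ and $b=d(y,z)$, the defect $\rho(x,y)+\rho(y,z)-\rho(x,z)$ is $ab$ if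
    -- $d(x,z)=a+b$, and $(n-a)(n-b)+(n-1)(n-2)/2$ if $d(x,z)=a+b-n$.
    rcases val_sub_triangle x y z with h | h
    · have h : ((z - x).val : ℝ) = (y - x).val + (z - y).val := by exact_mod_cast h
      rw [h]
      nlinarith
    · have h : ((z - x).val : ℝ) = (y - x).val + (z - y).val - n := by
        rw [eq_sub_iff_add_eq]; exact_mod_cast h
      rw [h]
      generalize ((y - x).val : ℝ) = a at *
      generalize ((z - y).val : ℝ) = b at *
      have h1 : 0 ≤ (n - a) * (n - b) := mul_nonneg (by linarith) (by linarith)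
      have hnn : (1 : ℝ) ≤ n := by linarith
      have h2 : 0 ≤ ((n : ℝ) - 1) * (n - 2) := mul_nonneg (by linarith) (by linarith)
      nlinarith

/-! ### Counting connected sets -/

lemma card_connectedSets_cycleGraph {n : ℕ} (hn : 2 ≤ n) :
    (connectedSets (SimpleGraph.cycleGraph n)).card = n * (n - 1) + 1 := by
  have : NeZero n := ⟨by omega⟩
  have h : connectedSets (SimpleGraph.cycleGraph n) = insert Finset.univ
      ((Finset.univ : Finset (Fin n)).offDiag.image fun p => arc p.1 p.2) := by
    ext S
    simp [mem_connectedSets_cycleGraph hn, eq_comm]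
  rw [h, Finset.card_insert_of_notMem, Finset.card_image_of_injOn, Finset.offDiag_card]
  · simp [Nat.mul_sub]
  · rintro ⟨i, j⟩ hij ⟨i', j'⟩ - heq
    have := arc_injective hn (by simpa using hij) heq
    exact Prod.ext this.1 this.2
  · simp only [Finset.mem_image, not_exists, not_and]
    rintro p - hp
    exact right_notMem_arc p.1 p.2 (hp ▸ Finset.mem_univ _)

/-- An arc of length `d` contains `d (d + 1) / 2` nonempty arcs. -/
lemma card_connectedSets_subset_arc {n : ℕ} (hn : 2 ≤ n) (i j : Fin n) :
    ((connectedSets (SimpleGraph.cycleGraph n)).filter (· ⊆ arc i j)).card * 2 =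
      (j - i).val * ((j - i).val + 1) := by
  have : NeZero n := ⟨by omega⟩
  -- Nonempty subarcs correspond to pairs of offsets $p<q\le d(i,j)$ from `i`.
  have h : (connectedSets (SimpleGraph.cycleGraph n)).filter (· ⊆ arc i j) =
      ((Finset.Iic (j - i)).sigma fun q => Finset.Iio q).image
        fun x => arc (i + x.2) (i + x.1) := by
    ext S
    simp only [Finset.mem_filter, mem_connectedSets_cycleGraph hn, Finset.mem_image,
      Finset.mem_sigma, Finset.mem_Iic, Finset.mem_Iio]
    constructor
    · rintro ⟨rfl | ⟨a, b, hab, rfl⟩, hS⟩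
      · exact absurd (hS (Finset.mem_univ j)) (right_notMem_arc i j)
      have hshift : ∀ k, (k ∈ arc a b → (k - i).val < (j - i).val) := by
        intro k hk
        simpa [mem_arc] using hS hk
      have hlast : b - 1 ∈ arc a b := by
        rw [mem_arc, Fin.lt_def, sub_right_comm, val_sub_one _ hn]
        have := (val_sub_eq_zero_iff a b).not.2 hab
        rw [if_neg this]
        omega
      have hb := hshift _ hlast
      rw [sub_right_comm, val_sub_one _ hn] at hb
      have hlt : (a - i).val < (b - i).val := by
        by_contra hle
        have ha := hshift a (left_mem_arc hab)
        have hab' : (b - i).val ≠ (a - i).val := fun h => hab (by simpa using (Fin.ext h).symm)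
        have hji := (j - i).2
        -- If the end did not come after the start as seen from `i`, the subarc would contain `i -
        -- 1`, at distance $n-1$ from `i`, which no arc $[i,j)^0$ contains.
        have hm : i - 1 ∈ arc a b := by
          rw [mem_arc, ← sub_sub_sub_cancel_right b a i, ← sub_sub_sub_cancel_right (i - 1) a i,
            Fin.lt_def, val_sub_eq_ite (b - i), val_sub_eq_ite (i - 1 - i)]
          rw [sub_right_comm, sub_self, val_sub_one _ hn]
          simp only [Fin.val_zero, if_true]
          split_ifs <;> omega
        have := hshift _ hm
        rw [sub_right_comm, sub_self, val_sub_one _ hn] at this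
        simp only [Fin.val_zero, if_true] at this
        omega
      refine ⟨⟨b - i, a - i⟩, ⟨?_, hlt⟩, by simp⟩
      change (b - i).val ≤ (j - i).val
      split_ifs at hb <;> omega
    · rintro ⟨⟨q, p⟩, ⟨hq, hp⟩, rfl⟩
      dsimp only at *
      refine ⟨Or.inr ⟨i + p, i + q, by simpa using hp.ne, rfl⟩, fun k hk => ?_⟩
      rw [mem_arc_add hp] at hk
      exact mem_arc.2 (hk.2.trans_le hq)
  rw [h, Finset.card_image_of_injOn, Finset.card_sigma]
  · simp only [Fin.card_Iio]
    have : ∑ q ∈ Finset.Iic (j - i), q.val = ∑ m ∈ Finset.range ((j - i).val + 1), m := by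
      refine Finset.sum_bij (fun q _ => q.val) (fun q hq => ?_) (fun q _ q' _ => Fin.ext)
        (fun m hm => ?_) fun _ _ => rfl
      · have := Fin.le_def.1 (Finset.mem_Iic.1 hq)
        exact Finset.mem_range.2 (by omega)
      · have hm := Finset.mem_range.1 hm
        have := (j - i).2
        exact ⟨⟨m, by omega⟩, Finset.mem_Iic.2 (Fin.le_def.2 (by simpa using by omega)), rfl⟩
    rw [this, Finset.sum_range_id_mul_two, Nat.add_sub_cancel, mul_comm]
  · rintro ⟨q, p⟩ hx ⟨q', p'⟩ - heq
    have hp : p < q := by simpa using (Finset.mem_sigma.1 hx).2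
    have := arc_injective hn (by simpa using hp.ne) heq
    simp only [add_right_inj] at this
    obtain ⟨rfl, rfl⟩ := this
    rfl

/-- The value at `e_i - e_j` of the support function of the cyclohedron. -/
lemma cycloDist_eq {n : ℕ} (hn : 2 ≤ n) (i j : Fin n) :
    cycloDist i j = ((arc i j).card : ℝ) / n * (connectedSets (SimpleGraph.cycleGraph n)).card -
      ((connectedSets (SimpleGraph.cycleGraph n)).filter (· ⊆ arc i j)).card := by
  have h : (((connectedSets (SimpleGraph.cycleGraph n)).filter (· ⊆ arc i j)).card : ℝ) * 2 =
      (j - i).val * ((j - i).val + 1) := by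
    exact_mod_cast card_connectedSets_subset_arc hn i j
  rw [cycloDist, clockDist_eq, card_connectedSets_cycleGraph hn, card_arc]
  push_cast [Nat.cast_sub (by omega : 1 ≤ n)]
  linear_combination (1 / 2 : ℝ) * h

/-! ### Hypergraph polytopes, polars and Kantorovich–Rubinstein polytopes -/

lemma simplex_subset {V : Type*} [Fintype V] [DecidableEq V] (S : Finset V) :
    simplex S ⊆ {x | (∀ i, 0 ≤ x i) ∧ ∀ T, S ⊆ T → ∑ i ∈ T, x i = 1} := by
  refine convexHull_min ?_ ?_
  · rintro _ ⟨i, hi, rfl⟩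
    refine ⟨fun j => ?_, fun T hT => ?_⟩
    · rw [PiLp.single_apply]; split_ifs <;> simp
    · simp [hT hi]
  · rintro x ⟨hx, hx'⟩ y ⟨hy, hy'⟩ a b ha hb hab
    refine ⟨fun i => ?_, fun T hT => ?_⟩
    · simpa using add_nonneg (mul_nonneg ha (hx i)) (mul_nonneg hb (hy i))
    · simp [Finset.sum_add_distrib, ← Finset.mul_sum, hx' T hT, hy' T hT, hab]

lemma sum_of_mem_hypergraphPolytope {V : Type*} [Fintype V] [DecidableEq V] {B : Finset (Finset V)}
    {x : EuclideanSpace ℝ V} (hx : x ∈ hypergraphPolytope B) :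
    ∑ i, x i = B.card ∧ ∀ T, ((B.filter (· ⊆ T)).card : ℝ) ≤ ∑ i ∈ T, x i := by
  obtain ⟨g, hg, rfl⟩ := (Set.mem_finsetSum B simplex x).1 hx
  have hg' : ∀ {S}, S ∈ B → _ := fun hS => simplex_subset _ (hg hS)
  have hsum : ∀ T : Finset V, ∑ i ∈ T, (∑ S ∈ B, g S) i = ∑ S ∈ B, ∑ i ∈ T, g S i := by
    intro T
    rw [Finset.sum_comm]
    simp
  refine ⟨?_, fun T => ?_⟩
  · rw [hsum, Finset.sum_congr rfl fun S hS => (hg' hS).2 _ (Finset.subset_univ S)]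
    simp
  · rw [hsum, Finset.card_filter]
    push_cast
    refine Finset.sum_le_sum fun S hS => ?_
    split_ifs with h
    · exact ((hg' hS).2 T h).ge
    · exact Finset.sum_nonneg fun i _ => (hg' hS).1 i

lemma sum_single_mem_hypergraphPolytope {V : Type*} [Fintype V] [DecidableEq V]
    {B : Finset (Finset V)} {f : Finset V → V} (hf : ∀ S ∈ B, f S ∈ S) :
    ∑ S ∈ B, EuclideanSpace.single (f S) (1 : ℝ) ∈ hypergraphPolytope B :=
  Set.finsetSum_mem_finsetSum _ _ _ fun S hS => subset_convexHull ℝ _ ⟨f S, hf S hS, rfl⟩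

lemma inner_toH0 {V : Type*} [Fintype V] (x y : EuclideanSpace ℝ V) (hy : ∑ i, y i = 0) :
    inner ℝ (toH0 x) y = ∑ i, x i * y i := by
  simp only [toH0, PiLp.inner_apply, RCLike.inner_apply, conj_trivial, mul_sub,
    Finset.sum_sub_distrib, ← Finset.sum_mul, hy, zero_mul, sub_zero]
  exact Finset.sum_congr rfl fun i _ => mul_comm _ _

lemma mem_polarH0_toH0_image {V : Type*} [Fintype V] {K : Set (EuclideanSpace ℝ V)}
    {y : EuclideanSpace ℝ V} :
    y ∈ polarH0 (toH0 '' K) ↔ ∑ i, y i = 0 ∧ ∀ x ∈ K, ∑ i, x i * y i ≤ 1 := by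
  rw [polarH0, Set.mem_ofPred_eq, Set.forall_mem_image]
  exact and_congr_right fun hy => forall₂_congr fun x _ => by rw [inner_toH0 x y hy]

lemma convex_polarH0 {V : Type*} [Fintype V] (K : Set (EuclideanSpace ℝ V)) :
    Convex ℝ (polarH0 K) := by
  rintro x ⟨hx, hx'⟩ y ⟨hy, hy'⟩ a b ha hb hab
  refine ⟨?_, fun z hz => ?_⟩
  · simp [Finset.sum_add_distrib, ← Finset.mul_sum, hx, hy]
  · rw [inner_add_right, inner_smul_right, inner_smul_right]
    nlinarith [mul_le_mul_of_nonneg_left (hx' z hz) ha, mul_le_mul_of_nonneg_left (hy' z hz) hb]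

lemma sum_eq_zero_of_mem_KR {X : Type*} [Fintype X] [DecidableEq X] {ρ : X → X → ℝ}
    {x : EuclideanSpace ℝ X} (hx : x ∈ KR ρ) : ∑ i, x i = 0 := by
  suffices KR ρ ⊆ {x | ∑ i, x i = 0} from this hx
  refine convexHull_min ?_ ?_
  · rintro _ ⟨i, j, -, rfl⟩
    simp [← Finset.mul_sum]
  · intro x hx y hy a b _ _ _
    rw [Set.mem_ofPred_eq] at *
    simp [Finset.sum_add_distrib, ← Finset.mul_sum, hx, hy]

/-- The generators for $(i,j)$ and $(j,i)$ point in opposite directions; weights proportional to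
$\rho$ cancel them. -/
lemma zero_mem_KR {X : Type*} [Fintype X] [DecidableEq X] {ρ : X → X → ℝ} {i j : X} (h : i ≠ j)
    (hij : 0 < ρ i j) (hji : 0 < ρ j i) : (0 : EuclideanSpace ℝ X) ∈ KR ρ := by
  have h1 := subset_convexHull ℝ {v | ∃ x y : X, x ≠ y ∧
    v = (ρ x y)⁻¹ • (EuclideanSpace.single x (1 : ℝ) - EuclideanSpace.single y (1 : ℝ))}
    ⟨i, j, h, rfl⟩
  have h2 := subset_convexHull ℝ {v | ∃ x y : X, x ≠ y ∧
    v = (ρ x y)⁻¹ • (EuclideanSpace.single x (1 : ℝ) - EuclideanSpace.single y (1 : ℝ))}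
    ⟨j, i, h.symm, rfl⟩
  have h3 := convex_convexHull ℝ _ h1 h2 (a := ρ i j / (ρ i j + ρ j i))
    (b := ρ j i / (ρ i j + ρ j i)) (by positivity) (by positivity) (by field_simp)
  rw [smul_smul, smul_smul, div_mul_eq_mul_div, div_mul_eq_mul_div, mul_inv_cancel₀ hij.ne',
    mul_inv_cancel₀ hji.ne', ← smul_add, sub_add_sub_cancel, sub_self, smul_zero] at h3
  exact h3

/-! ### The linear isomorphism -/

/-- The linear map sending `e_i - e_j` to the projection to `H_0` of minus the indicator of the
arc `[i, j)⁰`. -/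
noncomputable def arcMap (n : ℕ) : EuclideanSpace ℝ (Fin n) →ₗ[ℝ] EuclideanSpace ℝ (Fin n) where
  -- Column `i` is the centred indicator of the initial segment below `i`. A difference of two such
  -- indicators is minus that of an arc, up to a constant that centring removes.
  toFun x := WithLp.toLp 2 fun k => ∑ i, x i * ((if k < i then 1 else 0) - (i.val : ℝ) / n)
  map_add' x y := by
    ext k
    simp [add_mul, Finset.sum_add_distrib]
  map_smul' c x := by
    ext k
    simp [mul_assoc, Finset.mul_sum]

lemma arcMap_apply {n : ℕ} (x : EuclideanSpace ℝ (Fin n)) (k : Fin n) :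
    arcMap n x k = ∑ i, x i * ((if k < i then 1 else 0) - (i.val : ℝ) / n) := rfl

lemma arcMap_single_sub_single {n : ℕ} (i j k : Fin n) :
    arcMap n (EuclideanSpace.single i 1 - EuclideanSpace.single j 1) k =
      ((arc i j).card : ℝ) / n - if k ∈ arc i j then 1 else 0 := by
  have hn : (n : ℝ) ≠ 0 := by exact_mod_cast k.pos.ne'
  rw [map_sub, PiLp.sub_apply, arcMap_apply, arcMap_apply, card_arc]
  simp only [PiLp.single_apply, ite_mul, one_mul, zero_mul,
    Finset.sum_ite_eq', Finset.mem_univ, if_true]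
  have hi := i.2
  have hj := j.2
  have hk := k.2
  have hm : k ∈ arc i j ↔ if i ≤ j then i ≤ k ∧ k < j else i ≤ k ∨ k < j := by
    rw [mem_arc, Fin.lt_def, val_sub_eq_ite, val_sub_eq_ite]
    simp only [Fin.le_def, Fin.lt_def]
    split_ifs <;> omega
  rw [if_congr hm rfl rfl, val_sub_eq_ite]
  by_cases hij : i.val ≤ j.val
  · rw [if_pos hij, Nat.cast_sub hij]
    simp only [Fin.lt_def, Fin.le_def, if_pos hij]
    split_ifs <;> first | omega | (field_simp; ring)
  · rw [if_neg hij, Nat.cast_sub (by omega), Nat.cast_add]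
    simp only [Fin.lt_def, Fin.le_def, if_neg hij]
    split_ifs <;> first | omega | (field_simp; ring)

lemma arcMap_injOn {n : ℕ} :
    Set.InjOn (arcMap n) {x | ∑ i, x i = 0} := by
  intro x hx y hy hxy
  rw [Set.mem_ofPred_eq] at hx hy
  rw [← sub_eq_zero] at hxy ⊢
  rw [← map_sub] at hxy
  have hz : ∑ i, (x - y) i = 0 := by simp [hx, hy]
  generalize x - y = z at *
  have hpos : ∀ k : Fin n, k.val ≠ 0 → z k = 0 := by
    intro k hk
    -- Consecutive coordinates of the image differ by one coordinate of `z`; the coordinate at 0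
    -- then follows from the zero sum.
    have h1 : arcMap n z ⟨k.val - 1, by omega⟩ - arcMap n z k = z k := by
      rw [arcMap_apply, arcMap_apply, ← Finset.sum_sub_distrib, Finset.sum_eq_single k]
      · have : k.val - 1 < k.val := by omega
        simp [Fin.lt_def, this, ← mul_add]
      · intro i _ hik
        have hik := Fin.val_ne_of_ne hik
        have : (⟨k.val - 1, by omega⟩ : Fin n) < i ↔ k < i := by
          simp only [Fin.lt_def]; omega
        simp [this]
      · simp
    simpa [hxy] using h1.symm
  ext k
  by_cases hk : k.val = 0
  · rw [PiLp.zero_apply, ← hz, Finset.sum_eq_single k]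
    · intro i _ hik
      exact hpos i fun h => hik (Fin.ext (h.trans hk.symm))
    · simp
  · simpa using hpos k hk

/-- The origin absorbs the missing mass. Vectors with zero coefficient are unconstrained, which lets
`v F` below be meaningless when `F` is not an arc. -/
lemma sum_smul_mem_of_sum_le_one {E ι : Type*} [AddCommGroup E] [Module ℝ E] {K : Set E}
    (hK : Convex ℝ K) (h0 : 0 ∈ K) (t : Finset ι) (c : ι → ℝ) (v : ι → E)
    (hc : ∀ i ∈ t, 0 ≤ c i) (hsum : ∑ i ∈ t, c i ≤ 1) (hv : ∀ i ∈ t, c i ≠ 0 → v i ∈ K) :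
    ∑ i ∈ t, c i • v i ∈ K := by
  classical
  let w : ι → E := fun i => if c i = 0 then 0 else v i
  have hw : ∀ i ∈ t, w i ∈ K := by
    intro i hi
    by_cases h : c i = 0
    · simpa [w, h] using h0
    · simpa [w, h] using hv i hi h
  have hcw : ∑ i ∈ t, c i • v i = ∑ i ∈ t, c i • w i := by
    refine Finset.sum_congr rfl fun i _ => ?_
    by_cases h : c i = 0 <;> simp [w, h]
  have := hK.sum_mem (t := Finset.insertNone t) (w := fun o => o.elim (1 - ∑ i ∈ t, c i) c)
    (z := fun o => o.elim 0 w) ?_ ?_ ?_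
  · simpa [hcw] using this
  · rintro (_ | i) hi
    · simpa using hsum
    · exact hc i (by simpa using hi)
  · simp
  · rintro (_ | i) hi
    · exact h0
    · exact hw i (by simpa using hi)

/-! ### The two inclusions -/

lemma arcMap_image_KR_subset {n : ℕ} (hn : 2 ≤ n) :
    arcMap n '' KR (cycloDist : Fin n → Fin n → ℝ) ⊆ dualCyclohedron n := by
  rw [KR, LinearMap.image_convexHull]
  refine convexHull_min ?_ (convex_polarH0 _)
  rintro _ ⟨_, ⟨i, j, hij, rfl⟩, rfl⟩
  have hρ := cycloDist_pos hn hij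
  have hn' : (n : ℝ) ≠ 0 := by exact_mod_cast (by omega : n ≠ 0)
  rw [dualCyclohedron, mem_polarH0_toH0_image]
  simp only [map_smul, PiLp.smul_apply, smul_eq_mul, arcMap_single_sub_single]
  constructor
  · rw [← Finset.mul_sum, Finset.sum_sub_distrib]
    simp [mul_div_cancel₀ _ hn']
  · intro x hx
    obtain ⟨h1, h2⟩ := sum_of_mem_hypergraphPolytope hx
    have h3 : ∑ k, x k * ((cycloDist i j)⁻¹ *
        (((arc i j).card : ℝ) / n - if k ∈ arc i j then 1 else 0)) =
        (cycloDist i j)⁻¹ * (((arc i j).card : ℝ) / n * ∑ k, x k - ∑ k ∈ arc i j, x k) := by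
      have h4 : ∑ k ∈ arc i j, x k = ∑ k, if k ∈ arc i j then x k else 0 := by simp
      rw [h4, Finset.mul_sum, ← Finset.sum_sub_distrib, Finset.mul_sum]
      refine Finset.sum_congr rfl fun k _ => ?_
      split_ifs <;> ring
    rw [h3, inv_mul_le_one₀ hρ, h1, cycloDist_eq hn]
    linarith [h2 (arc i j)]

lemma union_mem_connectedSets {V : Type*} [Fintype V] [DecidableEq V] {G : SimpleGraph V}
    {S T : Finset V} (hS : S ∈ connectedSets G) (hT : T ∈ connectedSets G)
    (h : (S ∩ T).Nonempty) : S ∪ T ∈ connectedSets G := by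
  rw [mem_connectedSets] at *
  rw [Finset.coe_union]
  exact SimpleGraph.induce_union_connected hS.preconnected hT.preconnected (by exact_mod_cast h)

lemma dualCyclohedron_subset_arcMap_image {n : ℕ} (hn : 2 ≤ n) :
    dualCyclohedron n ⊆ arcMap n '' KR (cycloDist : Fin n → Fin n → ℝ) := by
  intro y hy
  have : NeZero n := ⟨by omega⟩
  have hn' : (n : ℝ) ≠ 0 := by exact_mod_cast (by omega : n ≠ 0)
  rw [dualCyclohedron, mem_polarH0_toH0_image] at hy
  obtain ⟨hy0, hy1⟩ := hy
  set B := connectedSets (SimpleGraph.cycleGraph n) with hB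
  obtain ⟨t, -, ht⟩ := Finset.univ.exists_max_image y Finset.univ_nonempty
  obtain ⟨a, ha0, haz, haS⟩ := exists_nested_decomposition B
    (fun v => mem_connectedSets.2 (by
      rw [Finset.coe_singleton]; exact SimpleGraph.Connected.of_subsingleton))
    (fun S hS T hT => union_mem_connectedSets hS hT)
    (fun S hS => by
      obtain ⟨⟨v, hv⟩⟩ := (mem_connectedSets.1 hS).nonempty
      exact ⟨v, hv⟩)
    (fun v => y t - y v) (fun v => sub_nonneg.2 (ht v (Finset.mem_univ v)))
  -- `f S` maximises `y` on `S`, so the sum of the $e_{f(S)}$ is a point of $W_n$ maximising the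
  -- pairing with `y`.
  choose! f hf hfa using haS
  have hsupport := hy1 _ (sum_single_mem_hypergraphPolytope hf)
  have hsupport' : ∑ i, (∑ S ∈ B, EuclideanSpace.single (f S) (1 : ℝ)) i * y i =
      B.card * y t - ∑ F ∈ B, a F * (B.filter (· ⊆ F)).card := by
    have h1 : ∑ i, (∑ S ∈ B, EuclideanSpace.single (f S) (1 : ℝ)) i * y i = ∑ S ∈ B, y (f S) := by
      simp only [WithLp.ofLp_sum, Finset.sum_apply, Finset.sum_mul]
      rw [Finset.sum_comm]
      simp [PiLp.single_apply]
    have h2 : ∀ S ∈ B, y (f S) = y t - ∑ F ∈ B, if S ⊆ F then a F else 0 := by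
      intro S hS
      rw [← hfa S hS]; ring
    rw [h1, Finset.sum_congr rfl h2, Finset.sum_sub_distrib, Finset.sum_comm]
    simp [Finset.sum_ite, mul_comm]
  rw [hsupport'] at hsupport
  -- Average the decomposition over all vertices, using that `y` sums to zero.
  have hmax : y t = ∑ F ∈ B, a F * ((F.card : ℝ) / n) := by
    have h1 : ∑ v, (y t - y v) = n * y t := by
      simp [Finset.sum_sub_distrib, hy0]
    rw [Finset.sum_congr rfl fun v _ => haz v, Finset.sum_comm] at h1
    rw [← mul_right_inj' hn', ← h1, Finset.mul_sum]
    refine Finset.sum_congr rfl fun F _ => ?_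
    rw [Finset.sum_ite_mem, Finset.univ_inter, Finset.sum_const, nsmul_eq_mul]
    field_simp
  -- The decomposed function vanishes at `t`, so no set containing `t` carries weight; only arcs
  -- remain.
  have huniv : a Finset.univ = 0 := by
    have h1 := haz t
    rw [sub_self] at h1
    have h2 := (Finset.sum_eq_zero_iff_of_nonneg fun F _ => by
      split_ifs <;> simp [ha0]).1 h1.symm Finset.univ
        ((mem_connectedSets_cycleGraph hn).2 (Or.inl rfl))
    simpa using h2
  let ρ : Finset (Fin n) → ℝ := fun F => (F.card : ℝ) / n * B.card - (B.filter (· ⊆ F)).card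
  let v : Finset (Fin n) → EuclideanSpace ℝ (Fin n) := fun F =>
    WithLp.toLp 2 fun k => (ρ F)⁻¹ * ((F.card : ℝ) / n - if k ∈ F then 1 else 0)
  have harc : ∀ F ∈ B, a F ≠ 0 → ∃ i j, i ≠ j ∧ F = arc i j := by
    intro F hF hne
    rcases (mem_connectedSets_cycleGraph hn).1 hF with rfl | h
    · exact absurd huniv hne
    · exact h
  have hρ : ∀ F ∈ B, a F ≠ 0 → 0 < ρ F := by
    intro F hF hne
    obtain ⟨i, j, hij, rfl⟩ := harc F hF hne
    simpa only [ρ, cycloDist_eq hn] using cycloDist_pos hn hij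
  have hyv : y = ∑ F ∈ B, (a F * ρ F) • v F := by
    ext k
    have h1 : y k = ∑ F ∈ B, a F * ((F.card : ℝ) / n - if k ∈ F then 1 else 0) := by
      have h2 := haz k
      simp only [mul_sub, Finset.sum_sub_distrib, mul_ite, mul_one, mul_zero]
      linarith
    rw [h1]
    simp only [WithLp.ofLp_sum, Finset.sum_apply, PiLp.smul_apply, smul_eq_mul]
    refine Finset.sum_congr rfl fun F hF => ?_
    by_cases h : a F = 0
    · simp [h]
    · rw [mul_assoc, mul_inv_cancel_left₀ (hρ F hF h).ne']
  rw [hyv]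
  have hzero : (0 : EuclideanSpace ℝ (Fin n)) ∈ KR (cycloDist : Fin n → Fin n → ℝ) := by
    have h01 : (⟨0, by omega⟩ : Fin n) ≠ ⟨1, by omega⟩ := by simp
    exact zero_mem_KR h01 (cycloDist_pos hn h01) (cycloDist_pos hn h01.symm)
  refine sum_smul_mem_of_sum_le_one ((convex_convexHull ℝ _).linear_image (arcMap n))
    ⟨0, hzero, map_zero _⟩ B _ v (fun F hF => ?_) ?_ fun F hF hne => ?_
  · by_cases h : a F = 0
    · simp [h]
    · exact mul_nonneg (ha0 F) (hρ F hF h).le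
  · refine le_trans (le_of_eq ?_) hsupport
    rw [hmax, Finset.mul_sum, ← Finset.sum_sub_distrib]
    exact Finset.sum_congr rfl fun F _ => by ring
  · obtain ⟨i, j, hij, rfl⟩ := harc F hF (left_ne_zero_of_mul hne)
    refine ⟨_, subset_convexHull ℝ _ ⟨i, j, hij, rfl⟩, ?_⟩
    ext k
    rw [map_smul, PiLp.smul_apply, arcMap_single_sub_single, cycloDist_eq hn]
    rfl

end CycloKR

theorem proposition5p14 (n : ℕ) (hn : 2 ≤ n) :
    CycloKR.IsQuasiMetric (CycloKR.clockDist : Fin n → Fin n → ℝ) ∧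
    CycloKR.IsQuasiMetric (CycloKR.cycloDist : Fin n → Fin n → ℝ) ∧
    CycloKR.AffinelyIsomorphic
      (CycloKR.KR (CycloKR.cycloDist : Fin n → Fin n → ℝ))
      (CycloKR.dualCyclohedron n) := by
  refine ⟨CycloKR.isQuasiMetric_clockDist n, CycloKR.isQuasiMetric_cycloDist hn,
    (CycloKR.arcMap n).toAffineMap, Set.mapsTo_iff_image_subset.2 ?_, ?_, ?_⟩
  · exact CycloKR.arcMap_image_KR_subset hn
  · exact CycloKR.arcMap_injOn.mono fun x hx => CycloKR.sum_eq_zero_of_mem_KR hx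
  · exact CycloKR.dualCyclohedron_subset_arcMap_image hn
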